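/- Conventions. A biframe $\mathcal L=(L^+,L^-,L)$ consists of frames $L^+,L^-,L$ and injective frame maps $e^\pm:L^\pm\to L$ such that every element of $L$ is a join of elements $e^+(x^+)\wedge e^-(x^-)$. A biframe map $\mathcal L\to\mathcal M$ is a pair of frame maps $f^\pm:L^\pm\to M^\pm$ for which there is a (necessarily unique) frame map $f:L\to M$ with $f e_L^\pm=e_M^\pm f^\pm$. An element of a frame is called finitary (with respect to two frame maps $P\to X$, $N\to X$ into it) if it is a finite join of meets of an element of the image of $P$ with one of the image of $N$; a congruence is finitary if it is generated by a set of pairs of finitary elements. A biframe is finitary if the kernel congruence of the canonical frame map $L^+\oplus L^-\to L$ from the frame coproduct is finitary. $\mathbf{BiFrm}_{\mathsf{fin}}$ is the full subcategory of finitary biframes. For $a$ in a frame $L$ let $\nabla(a)=\{(x,y):x\vee a=y\vee a\}$ and $\Delta(a)=\{(x,y):x\wedge a=y\wedge a\}$ be the closed and the open congruence of $a$, and let $\mathsf A(L)$ be the frame of all congruences on $L$. The assembly of a biframe $\mathcal L$ is the biframe $\mathsf A(\mathcal L)=(\mathsf A_{\nabla^+\Delta^-}(L),\mathsf A_{\nabla^-\Delta^+}(L),\mathsf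 A_{\mathsf{fin}}(L))$ of subframes of $\mathsf A(L)$: $\mathsf A_{\mathsf{fin}}(L)$ is generated by all $\nabla(x)$ with $x\in L$ and all $\Delta(s)$ with $s\in L$ finitary; $\mathsf A_{\nabla^+\Delta^-}(L)$ by all $\nabla(e^+(a))$, $a\in L^+$, and $\Delta(e^-(b))$, $b\in L^-$; and $\mathsf A_{\nabla^-\Delta^+}(L)$ by all $\nabla(e^-(b))$ and $\Delta(e^+(a))$. The canonical biframe map $\nabla_{\mathcal L}:\mathcal L\to\mathsf A(\mathcal L)$ is $a\mapsto\nabla(e^\pm(a))$. The assembly is a functor: $\mathsf A(f)$ sends a congruence $C$ to the congruence generated by $\{(f(x),f(y)):(x,y)\in C\}$, so that $\nabla(x)\mapsto\nabla(f(x))$ and $\Delta(x)\mapsto\Delta(f(x))$; it preserves finitary biframes. A bispace is a set with a positive and a negative topology; morphisms in $\mathbf{BiTop}$ are the maps that are continuous for both, and the isomorphisms are the bihomeomorphisms. The bispectrum $\mathsf{bpt}(\mathcal L)$ is the set of biframe maps $\mathcal L\to\mathbf 2=(2,2,2)$, whose positive opens are the sets $\{p:p^+(a)=1\}$, $a\in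 L^+$, and whose negative opens are the sets $\{p:p^-(b)=1\}$, $b\in L^-$; it is a contravariant functor by precomposition. The Skula bispace $Sk(X)$ of a bispace $X$ has the same points; its positive topology is generated by the positive open and the negative closed sets of $X$, its negative topology by the negative open and the positive closed sets of $X$; $Sk$ does not change the underlying maps. Theorem. (1) Let $\mathcal L$ be a biframe. For every $p\in\mathsf{bpt}(\mathcal L)$ there is a unique $\tilde p\in\mathsf{bpt}(\mathsf A(\mathcal L))$ with $\tilde p\circ\nabla_{\mathcal L}=p$, and the map $\alpha_{\mathcal L}:p\mapsto\tilde p$ is a bijection and a bihomeomorphism $Sk(\mathsf{bpt}(\mathcal L))\cong\mathsf{bpt}(\mathsf A(\mathcal L))$. (2) The maps $\alpha_{\mathcal L}$, for $\mathcal L$ finitary, form a natural isomorphism $Sk\circ\mathsf{bpt}\cong\mathsf{bpt}\circ\mathsf A^{\mathrm{op}}$ of functors $\mathbf{BiFrm}_{\mathsf{fin}}^{\mathrm{op}}\to\mathbf{BiTop}$. -/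

import Mathlib

universe u v w

namespace Bif

/-- A frame congruence: an equivalence relation compatible with finite meets and arbitrary joins. -/
@[ext]
structure FrameCongr (L : Type u) [Order.Frame L] where
  r : L → L → Prop
  iseqv : Equivalence r
  inf' : ∀ {a b c d : L}, r a b → r c d → r (a ⊓ c) (b ⊓ d)
  sSup' : ∀ s : Set (L × L), (∀ p ∈ s, r p.1 p.2) → r (sSup (Prod.fst '' s)) (sSup (Prod.snd '' s))

namespace FrameCongr

section basic

variable {L : Type u} [Order.Frame L]

theorem refl (C : FrameCongr L) (a : L) : C.r a a := C.iseqv.refl a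

theorem iSup (C : FrameCongr L) {ι : Sort w} {f g : ι → L} (h : ∀ i, C.r (f i) (g i)) :
    C.r (⨆ i, f i) (⨆ i, g i) := by
  have := C.sSup' (Set.range fun i => (f i, g i)) (by rintro _ ⟨i, rfl⟩; exact h i)
  rwa [← Set.range_comp, ← Set.range_comp] at this

theorem sup (C : FrameCongr L) {a b c d : L} (h : C.r a b) (h' : C.r c d) :
    C.r (a ⊔ c) (b ⊔ d) := by
  rw [sup_eq_iSup, sup_eq_iSup]
  exact C.iSup fun i => by cases i <;> simpa

/-- Congruences are ordered by inclusion. -/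
instance : PartialOrder (FrameCongr L) where
  le C D := ∀ a b, C.r a b → D.r a b
  le_refl _ _ _ h := h
  le_trans _ _ _ h h' a b hab := h' a b (h a b hab)
  le_antisymm C D h h' := by
    ext a b
    exact ⟨h a b, h' a b⟩

/-- Arbitrary meets of congruences are intersections. -/
instance : InfSet (FrameCongr L) where
  sInf S :=
    { r := fun a b => ∀ C ∈ S, C.r a b
      iseqv := ⟨fun a C _ => C.iseqv.refl a, fun h C hC => C.iseqv.symm (h C hC),
        fun h h' C hC => C.iseqv.trans (h C hC) (h' C hC)⟩
      inf' := fun h h' C hC => C.inf' (h C hC) (h' C hC)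
      sSup' := fun s hs C hC => C.sSup' s fun p hp => hs p hp C hC }

/-- Finite meets of congruences are intersections, too. -/
instance : CompleteLattice (FrameCongr L) where
  inf C D :=
    { r := fun a b => C.r a b ∧ D.r a b
      iseqv := ⟨fun a => ⟨C.refl a, D.refl a⟩, fun h => ⟨C.iseqv.symm h.1, D.iseqv.symm h.2⟩,
        fun h h' => ⟨C.iseqv.trans h.1 h'.1, D.iseqv.trans h.2 h'.2⟩⟩
      inf' := fun h h' => ⟨C.inf' h.1 h'.1, D.inf' h.2 h'.2⟩
      sSup' := fun s hs => ⟨C.sSup' s fun p hp => (hs p hp).1, D.sSup' s fun p hp => (hs p hp).2⟩ }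
  inf_le_left _ _ _ _ h := h.1
  inf_le_right _ _ _ _ h := h.2
  le_inf _ _ _ h h' a b hab := ⟨h a b hab, h' a b hab⟩
  __ := completeLatticeOfInf (FrameCongr L) fun _ =>
    ⟨fun D hD _ _ h => h D hD, fun _ hD a b h _ hC => hD hC a b h⟩

/-- The closed congruence `∇ a`, the least one which identifies `a` with `0`. -/
def nabla (a : L) : FrameCongr L where
  r x y := x ⊔ a = y ⊔ a
  iseqv := ⟨fun _ => rfl, fun h => h.symm, fun h h' => h.trans h'⟩
  inf' h h' := by rw [sup_inf_right, sup_inf_right, h, h']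
  sSup' s hs := by
    rcases s.eq_empty_or_nonempty with rfl | hne
    · simp
    · have : Nonempty s := hne.to_subtype
      rw [sSup_image', sSup_image', iSup_sup, iSup_sup]
      exact iSup_congr fun p => hs p p.2

/-- The open congruence `Δ b`, the least one which identifies `b` with `1`. -/
def delta (b : L) : FrameCongr L where
  r x y := x ⊓ b = y ⊓ b
  iseqv := ⟨fun _ => rfl, fun h => h.symm, fun h h' => h.trans h'⟩
  inf' {x y x' y'} h h' := by
    rw [inf_inf_distrib_right, h, h', ← inf_inf_distrib_right]
  sSup' s hs := by
    rw [sSup_image', sSup_image', iSup_inf_eq, iSup_inf_eq]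
    exact iSup_congr fun p => hs p p.2

/-- The principal congruence `∇ a ⊓ Δ b` is the least one which forces `a ≤ b`. -/
theorem nabla_inf_delta_le {a b : L} {C : FrameCongr L} :
    nabla a ⊓ delta b ≤ C ↔ C.r (a ⊓ b) a := by
  constructor
  · intro h
    apply h
    constructor
    · change a ⊓ b ⊔ a = a ⊔ a
      simp
    · change a ⊓ b ⊓ b = a ⊓ b
      simp
  · rintro h x y ⟨h1, h2⟩
    replace h1 : x ⊔ a = y ⊔ a := h1
    replace h2 : x ⊓ b = y ⊓ b := h2
    have hx : C.r (x ⊔ x ⊓ b) (x ⊔ y ⊓ a) := by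
      have h3 : C.r (y ⊓ (a ⊓ b)) (y ⊓ a) := C.inf' (C.refl y) h
      have h4 : y ⊓ (a ⊓ b) ≤ x ⊓ b :=
        le_inf (((le_inf inf_le_left (inf_le_right.trans inf_le_right)).trans h2.ge).trans
          inf_le_left) (inf_le_right.trans inf_le_right)
      have h5 := C.sup (C.refl (x ⊔ x ⊓ b)) h3
      rw [sup_eq_left.2 (h4.trans le_sup_right)] at h5
      simpa using h5
    have hy : C.r (y ⊔ y ⊓ b) (y ⊔ x ⊓ a) := by
      have h3 : C.r (x ⊓ (a ⊓ b)) (x ⊓ a) := C.inf' (C.refl x) h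
      have h4 : x ⊓ (a ⊓ b) ≤ y ⊓ b :=
        le_inf (((le_inf inf_le_left (inf_le_right.trans inf_le_right)).trans h2.le).trans
          inf_le_left) (inf_le_right.trans inf_le_right)
      have h5 := C.sup (C.refl (y ⊔ y ⊓ b)) h3
      rw [sup_eq_left.2 (h4.trans le_sup_right)] at h5
      simpa using h5
    have e : x ⊔ y ⊓ a = y ⊔ x ⊓ a := by
      apply le_antisymm
      · refine sup_le ?_ (inf_le_left.trans le_sup_left)
        have : x ≤ x ⊓ (y ⊔ a) := le_inf le_rfl (h1 ▸ le_sup_left)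
        rw [inf_sup_left] at this
        exact this.trans (sup_le (inf_le_right.trans le_sup_left) le_sup_right)
      · refine sup_le ?_ (inf_le_left.trans le_sup_left)
        have : y ≤ y ⊓ (x ⊔ a) := le_inf le_rfl (h1 ▸ le_sup_left)
        rw [inf_sup_left] at this
        exact this.trans (sup_le (inf_le_right.trans le_sup_left) le_sup_right)
    simp only [sup_inf_self] at hx hy
    exact C.iseqv.trans hx (e ▸ C.iseqv.symm hy)

theorem le_of_principal {C D : FrameCongr L} (h : ∀ a b, C.r (a ⊓ b) a → D.r (a ⊓ b) a) :
    C ≤ D := by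
  intro a b hab
  have h1 : C.r (a ⊓ b) a := by
    simpa using C.inf' (C.refl a) (C.iseqv.symm hab)
  have h2 : C.r (b ⊓ a) b := by
    simpa using C.inf' (C.refl b) hab
  exact D.iseqv.trans (D.iseqv.symm (h a b h1)) (inf_comm a b ▸ h b a h2)

theorem nabla_le {a : L} {C : FrameCongr L} : nabla a ≤ C ↔ C.r a ⊥ := by
  have h := nabla_inf_delta_le (a := a) (b := ⊥) (C := C)
  have e : delta (⊥ : L) = ⊤ := top_unique fun x y _ => by simp [delta]
  rw [e, inf_of_le_left le_top, inf_bot_eq] at h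
  exact h.trans ⟨fun h => C.iseqv.symm h, fun h => C.iseqv.symm h⟩

theorem isCompl (a : L) : IsCompl (nabla a) (delta a) := by
  refine ⟨disjoint_iff_inf_le.2 (nabla_inf_delta_le.2 ?_), codisjoint_iff_le_sup.2 ?_⟩
  · rw [inf_idem]; exact refl _ _
  · have h1 : (nabla a ⊔ delta a).r a ⊥ := nabla_le.1 le_sup_left
    have h2 : (nabla a ⊔ delta a).r ⊤ a :=
      (le_sup_right : delta a ≤ nabla a ⊔ delta a) _ _ (by simp [delta])
    intro x y _
    have h3 := FrameCongr.iseqv _ |>.trans h2 h1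
    have h4 : ∀ z, (nabla a ⊔ delta a).r z ⊥ := fun z => by
      simpa using (nabla a ⊔ delta a).inf' (FrameCongr.refl _ z) h3
    exact (nabla a ⊔ delta a).iseqv.trans (h4 x) ((nabla a ⊔ delta a).iseqv.symm (h4 y))

/-- The congruence corresponding to a nucleus. -/
def ofNucleus (n : Nucleus L) : FrameCongr L where
  r x y := n x = n y
  iseqv := ⟨fun _ => rfl, fun h => h.symm, fun h h' => h.trans h'⟩
  inf' h h' := by rw [n.map_inf, n.map_inf, h, h']
  sSup' s hs := by
    have key : ∀ x y : L, n x = n y ↔ n.restrict x = n.restrict y := fun x y => by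
      rw [Subtype.ext_iff]; rfl
    rw [key, map_sSup, map_sSup, ← Set.image_comp, ← Set.image_comp]
    exact congrArg sSup (Set.image_congr fun p hp => (key _ _).1 (hs p hp))

theorem r_sSup (C : FrameCongr L) (x : L) : C.r (sSup {y | C.r y x}) x := by
  have h : C.r (x ⊔ ⨆ y : {y | C.r y x}, y.1) (x ⊔ ⨆ _ : {y | C.r y x}, x) :=
    C.sup (C.refl x) (C.iSup fun y => y.2)
  have e1 : x ⊔ ⨆ y : {y | C.r y x}, y.1 = sSup {y | C.r y x} := by
    rw [sSup_eq_iSup']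
    exact sup_eq_right.2 (le_iSup (fun y : {y | C.r y x} => y.1) ⟨x, C.refl x⟩)
  have e2 : x ⊔ ⨆ _ : {y | C.r y x}, x = x := sup_eq_left.2 (iSup_le fun _ => le_rfl)
  rwa [e1, e2] at h

/-- The nucleus corresponding to a congruence sends `x` to the largest element congruent to it. -/
def toNucleus (C : FrameCongr L) : Nucleus L where
  toFun x := sSup {y | C.r y x}
  map_inf' x y := by
    apply le_antisymm
    · apply sSup_le
      intro z hz
      refine le_inf ?_ ?_
      · have : C.r (z ⊔ x) x := by
          simpa using C.sup hz (C.refl x)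
        exact le_sup_left.trans (le_sSup this)
      · have : C.r (z ⊔ y) y := by
          simpa using C.sup hz (C.refl y)
        exact le_sup_left.trans (le_sSup this)
    · exact le_sSup (C.inf' (C.r_sSup x) (C.r_sSup y))
  idempotent' x := le_sSup (C.iseqv.trans (C.r_sSup _) (C.r_sSup x))
  le_apply' x := le_sSup (C.refl x)

theorem toNucleus_eq (C : FrameCongr L) {x y : L} : C.toNucleus x = C.toNucleus y ↔ C.r x y := by
  constructor
  · intro h
    have hx := C.r_sSup x
    have hy := C.r_sSup y
    change sSup {z | C.r z x} = sSup {z | C.r z y} at h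
    rw [h] at hx
    exact C.iseqv.trans (C.iseqv.symm hx) hy
  · intro h
    change sSup {z | C.r z x} = sSup {z | C.r z y}
    congr 1
    ext z
    exact ⟨fun hz => C.iseqv.trans hz h, fun hz => C.iseqv.trans hz (C.iseqv.symm h)⟩

/-- Congruences correspond to nuclei. -/
def nucleusIso : FrameCongr L ≃o Nucleus L where
  toFun := toNucleus
  invFun := ofNucleus
  left_inv C := by
    ext x y
    exact C.toNucleus_eq
  right_inv n := by
    ext x
    change sSup {y | n y = n x} = n x
    apply le_antisymm
    · exact sSup_le fun y hy => n.le_apply.trans (le_of_eq hy)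
    · exact le_sSup (n.idempotent x)
  map_rel_iff' {C D} := by
    constructor
    · intro h x y hxy
      have h' : ∀ z, sSup {y | C.r y z} ≤ sSup {y | D.r y z} := h
      apply D.toNucleus_eq.1
      apply le_antisymm
      · rw [← D.toNucleus.idempotent y]
        refine D.toNucleus.monotone (le_trans ?_ (h' y))
        exact le_sSup hxy
      · rw [← D.toNucleus.idempotent x]
        refine D.toNucleus.monotone (le_trans ?_ (h' x))
        exact le_sSup (C.iseqv.symm hxy)
    · intro h x
      exact sSup_le_sSup fun y hy => h _ _ hy

/-- The frame of congruences of `L`: the assembly of the frame `L`. -/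
instance : Order.Frame (FrameCongr L) := .ofMinimalAxioms
  { inf_sSup_le_iSup_inf := fun a s => by
      rw [← (nucleusIso (L := L)).le_iff_le]
      simp only [map_inf, map_iSup, map_sSup, inf_sSup_eq, iSup_image]
      exact le_rfl }

/-- The congruence generated by a relation. -/
def gen (R : L → L → Prop) : FrameCongr L := sInf {C | ∀ a b, R a b → C.r a b}

theorem gen_le {R : L → L → Prop} {C : FrameCongr L} : gen R ≤ C ↔ ∀ a b, R a b → C.r a b :=
  ⟨fun h a b hab => h a b fun _ hD => hD a b hab, fun h => sInf_le h⟩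

theorem gen_of {R : L → L → Prop} {a b : L} (h : R a b) : (gen R).r a b := gen_le.1 le_rfl a b h

/-- The map `a ↦ ∇ a` is a frame homomorphism. -/
def nablaHom (L : Type u) [Order.Frame L] : FrameHom L (FrameCongr L) where
  toFun := nabla
  map_inf' a b := FrameCongr.ext <| by
    funext x y
    show (x ⊔ a ⊓ b = y ⊔ a ⊓ b) = (x ⊔ a = y ⊔ a ∧ x ⊔ b = y ⊔ b)
    rw [sup_inf_left, sup_inf_left]
    refine propext ⟨fun h => ⟨?_, ?_⟩, fun h => by rw [h.1, h.2]⟩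
    · have := congrArg (· ⊔ a) h
      simpa [← sup_inf_left, sup_assoc] using this
    · have := congrArg (· ⊔ b) h
      simpa [← sup_inf_left, sup_assoc] using this
  map_top' := top_unique fun x y _ => by simp [nabla]
  map_sSup' s := by
    apply eq_of_forall_ge_iff
    intro C
    simp only [nabla_le, sSup_le_iff, Set.forall_mem_image]
    constructor
    · intro h a ha
      have := C.inf' (C.refl a) h
      simpa [inf_eq_left.2 (le_sSup ha)] using this
    · intro h
      have := C.iSup (f := fun a : s => a.1) (g := fun _ => ⊥) fun a => h a.2
      simpa [sSup_eq_iSup'] using this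

theorem delta_inf (a b : L) : delta (a ⊓ b) = delta a ⊔ delta b := by
  have h := (isCompl a).inf_sup (isCompl b)
  rw [← show nabla (a ⊓ b) = nabla a ⊓ nabla b from map_inf (nablaHom L) a b] at h
  exact (isCompl (a ⊓ b)).right_unique h

theorem delta_sup (a b : L) : delta (a ⊔ b) = delta a ⊓ delta b := by
  have h := (isCompl a).sup_inf (isCompl b)
  rw [← show nabla (a ⊔ b) = nabla a ⊔ nabla b from map_sup (nablaHom L) a b] at h
  exact (isCompl (a ⊔ b)).right_unique h

theorem delta_bot : delta (⊥ : L) = ⊤ := top_unique fun x y _ => by simp [delta]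

theorem eq_iSup (C : FrameCongr L) :
    C = ⨆ p : {p : L × L // C.r (p.1 ⊓ p.2) p.1}, nabla p.1.1 ⊓ delta p.1.2 :=
  le_antisymm
    (le_of_principal fun a b h => nabla_inf_delta_le.1
      (le_iSup (fun p : {p : L × L // C.r (p.1 ⊓ p.2) p.1} => nabla p.1.1 ⊓ delta p.1.2)
        ⟨(a, b), h⟩))
    (iSup_le fun p => nabla_inf_delta_le.2 p.2)

end basic

section functoriality

variable {L : Type u} {M : Type v} {N : Type w} [Order.Frame L] [Order.Frame M] [Order.Frame N]

/-- The preimage of a congruence under a frame homomorphism. -/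
def comap (f : FrameHom L M) (D : FrameCongr M) : FrameCongr L where
  r x y := D.r (f x) (f y)
  iseqv := ⟨fun _ => D.refl _, fun h => D.iseqv.symm h, fun h h' => D.iseqv.trans h h'⟩
  inf' h h' := by
    rw [map_inf, map_inf]
    exact D.inf' h h'
  sSup' s hs := by
    rw [map_sSup, map_sSup, ← Set.image_comp, ← Set.image_comp, sSup_image', sSup_image']
    exact D.iSup fun p : s => hs p p.2

/-- The kernel of a frame homomorphism. -/
def ker (f : FrameHom L M) : FrameCongr L where
  r x y := f x = f y
  iseqv := ⟨fun _ => rfl, fun h => h.symm, fun h h' => h.trans h'⟩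
  inf' h h' := by rw [map_inf, map_inf, h, h']
  sSup' s hs := by
    rw [map_sSup, map_sSup, ← Set.image_comp, ← Set.image_comp]
    exact congrArg sSup (Set.image_congr hs)

/-- The congruence generated by the image of a congruence under a frame homomorphism. -/
def map (f : FrameHom L M) (C : FrameCongr L) : FrameCongr M :=
  gen fun u v => ∃ x y, C.r x y ∧ f x = u ∧ f y = v

theorem map_le {f : FrameHom L M} {C : FrameCongr L} {D : FrameCongr M} :
    map f C ≤ D ↔ C ≤ comap f D := by
  rw [map, gen_le]
  exact ⟨fun h a b hab => h _ _ ⟨a, b, hab, rfl, rfl⟩,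
    by rintro h _ _ ⟨a, b, hab, rfl, rfl⟩; exact h a b hab⟩

theorem map_gc (f : FrameHom L M) : GaloisConnection (map f) (comap f) := fun _ _ => map_le

theorem map_principal (f : FrameHom L M) (a b : L) :
    map f (nabla a ⊓ delta b) = nabla (f a) ⊓ delta (f b) := by
  apply eq_of_forall_ge_iff
  intro D
  rw [map_le, nabla_inf_delta_le, nabla_inf_delta_le, ← map_inf]
  rfl

theorem map_nabla (f : FrameHom L M) (a : L) : map f (nabla a) = nabla (f a) := by
  simpa [delta_bot] using map_principal f a ⊥

theorem nabla_top : nabla (⊤ : L) = ⊤ := top_unique fun x y _ => by simp [nabla]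

theorem map_delta (f : FrameHom L M) (b : L) : map f (delta b) = delta (f b) := by
  simpa [nabla_top] using map_principal f ⊤ b

/-- The functorial action `A(f) : A(L) → A(M)` of the assembly of frames. -/
def mapHom (f : FrameHom L M) : FrameHom (FrameCongr L) (FrameCongr M) where
  toFun := map f
  map_inf' C D := by
    apply le_antisymm
    · exact le_inf ((map_gc f).monotone_l inf_le_left) ((map_gc f).monotone_l inf_le_right)
    · nth_rewrite 1 [C.eq_iSup]
      nth_rewrite 1 [D.eq_iSup]
      rw [(map_gc f).l_iSup, (map_gc f).l_iSup, iSup_inf_iSup]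
      refine iSup_le fun p => ?_
      rw [map_principal, map_principal, inf_inf_inf_comm, ← delta_sup, ← map_sup]
      rw [← show nabla (f p.1.1.1 ⊓ f p.2.1.1) = nabla (f p.1.1.1) ⊓ nabla (f p.2.1.1) from
        map_inf (nablaHom M) _ _, ← map_inf, ← map_principal]
      apply (map_gc f).monotone_l
      rw [show nabla (p.1.1.1 ⊓ p.2.1.1) = nabla (p.1.1.1) ⊓ nabla (p.2.1.1) from
        map_inf (nablaHom L) _ _, delta_sup, inf_inf_inf_comm]
      exact inf_le_inf (nabla_inf_delta_le.2 p.1.2) (nabla_inf_delta_le.2 p.2.2)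
  map_top' := by
    rw [← nabla_top, map_nabla, map_top, nabla_top]
  map_sSup' s := by rw [(map_gc f).l_sSup, sSup_image]

end functoriality
end FrameCongr

section quotient

variable {L : Type u} {M : Type v} {N : Type w} [Order.Frame L] [Order.Frame M] [Order.Frame N]

/-- A frame homomorphism factors through a surjective one with smaller kernel. -/
theorem exists_factor (c : FrameHom L M) (hc : Function.Surjective c) (k : FrameHom L N)
    (h : FrameCongr.ker c ≤ FrameCongr.ker k) : ∃ g : FrameHom M N, ∀ x, g (c x) = k x := by
  choose σ hσ using hc
  have hk : ∀ x, k (σ (c x)) = k x := fun x => h _ _ (hσ (c x))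
  refine ⟨{ toFun := fun y => k (σ y), map_inf' := ?_, map_top' := ?_, map_sSup' := ?_ }, hk⟩
  · intro a b
    rw [← map_inf, ← hk (σ a ⊓ σ b), map_inf, hσ, hσ]
  · rw [← map_top c, hk, map_top]
  · intro s
    change k (σ (sSup s)) = sSup ((fun y => k (σ y)) '' s)
    have e : c (sSup (σ '' s)) = sSup s := by
      rw [map_sSup, ← Set.image_comp]
      simp [hσ]
    rw [← e, hk, map_sSup, ← Set.image_comp]
    rfl

end quotient

/-- A subframe: a subset closed under finite meets and arbitrary joins. -/
structure Subframe (L : Type u) [Order.Frame L] where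
  carrier : Set L
  top_mem : ⊤ ∈ carrier
  inf_mem : ∀ {a b}, a ∈ carrier → b ∈ carrier → a ⊓ b ∈ carrier
  sSup_mem : ∀ {s}, s ⊆ carrier → sSup s ∈ carrier

namespace Subframe

variable {L : Type u} {M : Type v} [Order.Frame L] [Order.Frame M]

instance : SetLike (Subframe L) L where
  coe S := S.carrier
  coe_injective S T h := by cases S; cases T; congr

instance (S : Subframe L) : SupSet S where
  sSup s := ⟨sSup (Subtype.val '' s), S.sSup_mem (by rintro _ ⟨x, _, rfl⟩; exact x.2)⟩

instance (S : Subframe L) : CompleteLattice S where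
  inf a b := ⟨a.1 ⊓ b.1, S.inf_mem a.2 b.2⟩
  inf_le_left a b := show a.1 ⊓ b.1 ≤ a.1 from inf_le_left
  inf_le_right a b := show a.1 ⊓ b.1 ≤ b.1 from inf_le_right
  le_inf a b c h h' := show a.1 ≤ b.1 ⊓ c.1 from le_inf h h'
  top := ⟨⊤, S.top_mem⟩
  le_top a := show a.1 ≤ ⊤ from le_top
  __ := completeLatticeOfSup S fun s =>
    ⟨fun a ha => show a.1 ≤ sSup (Subtype.val '' s) from le_sSup ⟨a, ha, rfl⟩,
      fun b hb => show sSup (Subtype.val '' s) ≤ b.1 from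
        sSup_le (by rintro _ ⟨x, hx, rfl⟩; exact hb hx)⟩

theorem coe_sSup (S : Subframe L) (s : Set S) : (sSup s).1 = sSup (Subtype.val '' s) := rfl

instance (S : Subframe L) : Order.Frame S := .ofMinimalAxioms
  { inf_sSup_le_iSup_inf := fun a s => by
      change a.1 ⊓ sSup (Subtype.val '' s) ≤ (⨆ b ∈ s, a ⊓ b).1
      rw [inf_sSup_eq]
      refine iSup₂_le ?_
      rintro _ ⟨b, hb, rfl⟩
      exact (le_iSup₂ (f := fun b (_ : b ∈ s) => a ⊓ b) b hb :) }

/-- The inclusion of a subframe. -/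
def subtype (S : Subframe L) : FrameHom S L where
  toFun := Subtype.val
  map_inf' _ _ := rfl
  map_top' := rfl
  map_sSup' _ := rfl

/-- The inclusion of a subframe in a larger one. -/
def inclusion {S T : Subframe L} (h : ∀ x ∈ S, x ∈ T) : FrameHom S T where
  toFun x := ⟨x.1, h x.1 x.2⟩
  map_inf' _ _ := rfl
  map_top' := rfl
  map_sSup' s := Subtype.ext <| by
    rw [coe_sSup, coe_sSup, ← Set.image_comp]
    rfl

/-- A frame homomorphism with values in a subframe, as a homomorphism to that subframe. -/
def codRestrict (f : FrameHom L M) (T : Subframe M) (h : ∀ x, f x ∈ T) : FrameHom L T where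
  toFun x := ⟨f x, h x⟩
  map_inf' a b := Subtype.ext (map_inf f a b)
  map_top' := Subtype.ext (map_top f)
  map_sSup' s := Subtype.ext <| by
    change f (sSup s) = sSup (Subtype.val '' _)
    rw [map_sSup, ← Set.image_comp]
    rfl

/-- The subframe generated by a subset. -/
def closure (s : Set L) : Subframe L where
  carrier := {x | ∀ S : Subframe L, s ⊆ S.carrier → x ∈ S.carrier}
  top_mem S _ := S.top_mem
  inf_mem h h' S hS := S.inf_mem (h S hS) (h' S hS)
  sSup_mem h S hS := S.sSup_mem fun _ hx => h hx S hS

theorem subset_closure {s : Set L} {x : L} (h : x ∈ s) : x ∈ closure s := fun _ hS => hS h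

theorem closure_le {s : Set L} {S : Subframe L} (h : ∀ x ∈ s, x ∈ S) : ∀ x ∈ closure s, x ∈ S :=
  fun _ hx => hx S h

/-- The preimage of a subframe. -/
def comap (f : FrameHom L M) (T : Subframe M) : Subframe L where
  carrier := {x | f x ∈ T}
  top_mem := by
    change f ⊤ ∈ T
    rw [map_top]
    exact T.top_mem
  inf_mem {a b} h h' := by
    change f (a ⊓ b) ∈ T
    rw [map_inf]
    exact T.inf_mem h h'
  sSup_mem {s} h := by
    change f (sSup s) ∈ T
    rw [map_sSup]
    exact T.sSup_mem (by rintro _ ⟨x, hx, rfl⟩; exact h hx)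

/-- The range of a frame homomorphism. -/
def range (f : FrameHom L M) : Subframe M where
  carrier := Set.range f
  top_mem := ⟨⊤, map_top f⟩
  inf_mem := by
    rintro _ _ ⟨a, rfl⟩ ⟨b, rfl⟩
    exact ⟨a ⊓ b, map_inf f a b⟩
  sSup_mem {s} h := ⟨sSup (f ⁻¹' s), by rw [map_sSup, Set.image_preimage_eq_of_subset h]⟩

/-- The restriction of a frame homomorphism to subframes. -/
def restrict (f : FrameHom L M) (S : Subframe L) (T : Subframe M) (h : ∀ x ∈ S, f x ∈ T) :
    FrameHom S T where
  toFun x := ⟨f x.1, h x.1 x.2⟩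
  map_inf' a b := Subtype.ext (map_inf f a.1 b.1)
  map_top' := Subtype.ext (map_top f)
  map_sSup' s := Subtype.ext <| by
    change f (sSup (Subtype.val '' s)) = sSup (Subtype.val '' _)
    rw [map_sSup, ← Set.image_comp, ← Set.image_comp]
    rfl

theorem map_mem_closure {f : FrameHom L M} {s : Set L} {T : Subframe M} (h : ∀ x ∈ s, f x ∈ T) :
    ∀ x ∈ closure s, f x ∈ T :=
  closure_le (S := comap f T) h

theorem hom_ext {s : Set L} {f g : FrameHom (closure s) M}
    (h : ∀ x, ∀ hx : x ∈ s, f ⟨x, subset_closure hx⟩ = g ⟨x, subset_closure hx⟩) : f = g := by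
  let T : Subframe L :=
    { carrier := {x | ∃ hx : x ∈ closure s, f ⟨x, hx⟩ = g ⟨x, hx⟩}
      top_mem := ⟨(closure s).top_mem, (map_top f).trans (map_top g).symm⟩
      inf_mem := by
        rintro a b ⟨ha, ha'⟩ ⟨hb, hb'⟩
        refine ⟨(closure s).inf_mem ha hb, ?_⟩
        change f (⟨a, ha⟩ ⊓ ⟨b, hb⟩) = g (⟨a, ha⟩ ⊓ ⟨b, hb⟩)
        rw [map_inf, map_inf, ha', hb']
      sSup_mem := by
        intro t ht
        refine ⟨(closure s).sSup_mem fun x hx => (ht hx).1, ?_⟩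
        have e : (⟨sSup t, (closure s).sSup_mem fun x hx => (ht hx).1⟩ : closure s) =
            sSup (Subtype.val ⁻¹' t) := Subtype.ext <| by
          rw [coe_sSup, Set.image_preimage_eq_of_subset]
          intro x hx
          exact ⟨⟨x, (ht hx).1⟩, rfl⟩
        rw [e, map_sSup, map_sSup]
        exact congrArg sSup (Set.image_congr fun x hx => (ht hx).2) }
  ext x
  exact (closure_le (S := T) (fun y hy => ⟨subset_closure hy, h y hy⟩) x.1 x.2).2

end Subframe

/-- The coproduct `P ⊕ N` of two frames as a sublocale of the frame of down-sets of `P × N`: its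
elements are the down-sets which are closed under joins in either coordinate. -/
def coprodSublocale (P : Type u) (N : Type v) [Order.Frame P] [Order.Frame N] :
    Sublocale (LowerSet (P × N)) where
  carrier := {D | (∀ (s : Set P) (y : N), (∀ x ∈ s, (x, y) ∈ D) → (sSup s, y) ∈ D) ∧
    ∀ (x : P) (s : Set N), (∀ y ∈ s, (x, y) ∈ D) → (x, sSup s) ∈ D}
  sInf_mem' S hS := by
    simp only [Set.mem_ofPred_eq, LowerSet.mem_sInf_iff]
    exact ⟨fun s y h D hD => (hS hD).1 s y fun x hx => h x hx D hD,
      fun x s h D hD => (hS hD).2 x s fun y hy => h y hy D hD⟩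
  himp_mem' A B hB := by
    have key : ∀ p : P × N, p ∈ A ⇨ B ↔ ∀ q ≤ p, q ∈ A → q ∈ B := by
      intro p
      rw [← LowerSet.Iic_le, le_himp_iff]
      exact ⟨fun h q hq hA => h ⟨hq, hA⟩, fun h q hq => h q hq.1 hq.2⟩
    constructor
    · intro s y h
      rw [key]
      rintro ⟨u, v⟩ ⟨h1, h2⟩ hA
      have e : u = sSup ((fun x => x ⊓ u) '' s) := by
        rw [sSup_image, ← sSup_inf_eq]
        exact (inf_eq_right.2 h1).symm
      rw [e]
      apply hB.1
      rintro _ ⟨x, hx, rfl⟩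
      exact (key _).1 (h x hx) (x ⊓ u, v) ⟨inf_le_left, h2⟩
        (A.lower (a := (u, v)) ⟨inf_le_right, le_rfl⟩ hA)
    · intro x s h
      rw [key]
      rintro ⟨u, v⟩ ⟨h1, h2⟩ hA
      have e : v = sSup ((fun y => y ⊓ v) '' s) := by
        rw [sSup_image, ← sSup_inf_eq]
        exact (inf_eq_right.2 h2).symm
      rw [e]
      apply hB.2
      rintro _ ⟨y, hy, rfl⟩
      exact (key _).1 (h y hy) (u, y ⊓ v) ⟨h1, inf_le_left⟩
        (A.lower (a := (u, v)) ⟨le_rfl, inf_le_right⟩ hA)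

/-- The coproduct of two frames. -/
abbrev Coprod (P : Type u) (N : Type v) [Order.Frame P] [Order.Frame N] : Type (max u v) :=
  coprodSublocale P N

namespace Coprod

variable {P : Type u} {N : Type v} {M : Type w} [Order.Frame P] [Order.Frame N] [Order.Frame M]

theorem sSup_le_iff' {S : Set (Coprod P N)} {D : Coprod P N} :
    sSup S ≤ D ↔ ∀ E ∈ S, ∀ p, p ∈ E.1 → p ∈ D.1 :=
  sSup_le_iff

/-- The first coproduct injection: `a` is sent to the element generated by `(a, 1)`. -/
def inl : FrameHom P (Coprod P N) where
  toFun a := ⟨⟨{p | p.1 ≤ a ∨ p.2 = ⊥}, by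
    rintro ⟨x, y⟩ ⟨x', y'⟩ ⟨h1, h2⟩ (h | h)
    · exact Or.inl (le_trans h1 h)
    · exact Or.inr (le_bot_iff.1 (le_trans h2 (le_of_eq h)))⟩, by
    constructor
    · intro s y h
      by_cases hy : y = ⊥
      · exact Or.inr hy
      · exact Or.inl (sSup_le fun x hx => (h x hx).resolve_right hy)
    · intro x s h
      by_cases hx : x ≤ a
      · exact Or.inl hx
      · exact Or.inr (sSup_eq_bot.2 fun y hy => (h y hy).resolve_left hx)⟩
  map_inf' a b := by
    ext ⟨x, y⟩
    change (x ≤ a ⊓ b ∨ y = ⊥) ↔ (x ≤ a ∨ y = ⊥) ∧ (x ≤ b ∨ y = ⊥)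
    rw [le_inf_iff]
    tauto
  map_top' := top_unique fun p _ => Or.inl le_top
  map_sSup' s := by
    apply le_antisymm
    · generalize hT : sSup ((_ : P → Coprod P N) '' s) = T
      have hT' : ∀ a ∈ s, ∀ p : P × N, p.1 ≤ a → p ∈ T.1 := fun a ha p hp =>
        sSup_le_iff'.1 (le_of_eq hT) _ ⟨a, ha, rfl⟩ p (Or.inl hp)
      rintro ⟨x, y⟩ (h | h)
      · have h1 : (sSup ((fun a => a ⊓ x) '' s), y) ∈ T.1 := by
          apply T.2.1
          rintro _ ⟨a, ha, rfl⟩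
          exact hT' a ha _ inf_le_left
        rw [sSup_image, ← sSup_inf_eq, inf_eq_right.2 h] at h1
        exact h1
      · change y = ⊥ at h
        have := T.2.2 x ∅ (by simp)
        rw [sSup_empty, ← h] at this
        exact this
    · apply sSup_le_iff'.2
      rintro _ ⟨a, ha, rfl⟩ ⟨x, y⟩ (h | h)
      · exact Or.inl (le_trans h (le_sSup ha))
      · exact Or.inr h

/-- The second coproduct injection: `b` is sent to the element generated by `(1, b)`. -/
def inr : FrameHom N (Coprod P N) where
  toFun b := ⟨⟨{p | p.2 ≤ b ∨ p.1 = ⊥}, by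
    rintro ⟨x, y⟩ ⟨x', y'⟩ ⟨h1, h2⟩ (h | h)
    · exact Or.inl (le_trans h2 h)
    · exact Or.inr (le_bot_iff.1 (le_trans h1 (le_of_eq h)))⟩, by
    constructor
    · intro s y h
      by_cases hy : y ≤ b
      · exact Or.inl hy
      · exact Or.inr (sSup_eq_bot.2 fun x hx => (h x hx).resolve_left hy)
    · intro x s h
      by_cases hx : x = ⊥
      · exact Or.inr hx
      · exact Or.inl (sSup_le fun y hy => (h y hy).resolve_right hx)⟩
  map_inf' a b := by
    ext ⟨x, y⟩
    change (y ≤ a ⊓ b ∨ x = ⊥) ↔ (y ≤ a ∨ x = ⊥) ∧ (y ≤ b ∨ x = ⊥)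
    rw [le_inf_iff]
    tauto
  map_top' := top_unique fun p _ => Or.inl le_top
  map_sSup' s := by
    apply le_antisymm
    · generalize hT : sSup ((_ : N → Coprod P N) '' s) = T
      have hT' : ∀ a ∈ s, ∀ p : P × N, p.2 ≤ a → p ∈ T.1 := fun a ha p hp =>
        sSup_le_iff'.1 (le_of_eq hT) _ ⟨a, ha, rfl⟩ p (Or.inl hp)
      rintro ⟨x, y⟩ (h | h)
      · have h1 : (x, sSup ((fun a => a ⊓ y) '' s)) ∈ T.1 := by
          apply T.2.2
          rintro _ ⟨a, ha, rfl⟩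
          exact hT' a ha _ inf_le_left
        rw [sSup_image, ← sSup_inf_eq, inf_eq_right.2 h] at h1
        exact h1
      · change x = ⊥ at h
        have := T.2.1 ∅ y (by simp)
        rw [sSup_empty, ← h] at this
        exact this
    · apply sSup_le_iff'.2
      rintro _ ⟨a, ha, rfl⟩ ⟨x, y⟩ (h | h)
      · exact Or.inl (le_trans h (le_sSup ha))
      · exact Or.inr h

theorem inl_inf_inr_le {x : P} {y : N} {D : Coprod P N} (h : (x, y) ∈ D.1) :
    inl x ⊓ inr y ≤ D := by
  rintro ⟨u, v⟩ ⟨h1 | h1, h2 | h2⟩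
  · exact D.1.lower (a := (x, y)) ⟨h1, h2⟩ h
  · have := D.2.1 ∅ v (by simp)
    rw [sSup_empty] at this
    change u = ⊥ at h2
    exact h2 ▸ this
  · have := D.2.2 u ∅ (by simp)
    rw [sSup_empty] at this
    change v = ⊥ at h1
    exact h1 ▸ this
  · have := D.2.1 ∅ v (by simp)
    rw [sSup_empty] at this
    change u = ⊥ at h2
    exact h2 ▸ this

theorem eq_iSup (D : Coprod P N) : D = ⨆ p : {p // p ∈ D.1}, inl p.1.1 ⊓ inr p.1.2 := by
  apply le_antisymm
  · intro p hp
    have h : inl p.1 ⊓ inr p.2 ≤ ⨆ p : {p // p ∈ D.1}, (inl p.1.1 ⊓ inr p.1.2 : Coprod P N) :=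
      le_iSup (fun p : {p // p ∈ D.1} => (inl p.1.1 ⊓ inr p.1.2 : Coprod P N)) ⟨p, hp⟩
    exact h ⟨Or.inl le_rfl, Or.inl le_rfl⟩
  · exact iSup_le fun p => inl_inf_inr_le p.2

/-- The copairing `P ⊕ N → M` of two frame homomorphisms. -/
def desc (f : FrameHom P M) (g : FrameHom N M) : FrameHom (Coprod P N) M where
  toFun D := ⨆ p : {p // p ∈ D.1}, f p.1.1 ⊓ g p.1.2
  map_inf' D E := by
    rw [iSup_inf_iSup]
    apply le_antisymm
    · refine iSup_le fun p => ?_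
      refine le_trans ?_ (le_iSup _ (⟨p.1, p.2.1⟩, ⟨p.1, p.2.2⟩))
      simp
    · refine iSup_le fun p => ?_
      refine le_trans ?_ (le_iSup _ ⟨p.1.1 ⊓ p.2.1,
        D.1.lower inf_le_left p.1.2, E.1.lower inf_le_right p.2.2⟩)
      simp only [Prod.fst_inf, Prod.snd_inf, map_inf]
      rw [inf_inf_inf_comm]
  map_top' := top_unique <| le_trans (by simp) (le_iSup _ ⟨(⊤, ⊤), trivial⟩)
  map_sSup' S := by
    apply le_antisymm
    · set m := sSup ((fun D : Coprod P N => ⨆ p : {p // p ∈ D.1}, f p.1.1 ⊓ g p.1.2) '' S) with hm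
      let T : Coprod P N := ⟨⟨{p | f p.1 ⊓ g p.2 ≤ m}, by
        rintro p q h hp
        exact le_trans (inf_le_inf (OrderHomClass.mono f h.1) (OrderHomClass.mono g h.2)) hp⟩, by
        constructor
        · intro s y h
          change f (sSup s) ⊓ g y ≤ m
          rw [map_sSup, sSup_image, iSup₂_inf_eq]
          exact iSup₂_le h
        · intro x s h
          change f x ⊓ g (sSup s) ≤ m
          rw [map_sSup, sSup_image, inf_iSup₂_eq]
          exact iSup₂_le h⟩
      have h : sSup S ≤ T := sSup_le_iff'.2 fun E hE p hp =>
        le_trans (le_iSup (fun p : {p // p ∈ E.1} => f p.1.1 ⊓ g p.1.2) ⟨p, hp⟩)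
          (le_sSup ⟨E, hE, rfl⟩)
      exact iSup_le fun p => h p.2
    · apply sSup_le
      rintro _ ⟨D, hD, rfl⟩
      refine iSup_le fun p => ?_
      exact le_iSup (fun p : {p // p ∈ (sSup S).1} => f p.1.1 ⊓ g p.1.2)
        ⟨p.1, sSup_le_iff'.1 le_rfl D hD _ p.2⟩

theorem desc_inl (f : FrameHom P M) (g : FrameHom N M) (a : P) : desc f g (inl a) = f a := by
  apply le_antisymm
  · refine iSup_le ?_
    rintro ⟨⟨x, y⟩, h | h⟩
    · exact inf_le_left.trans (OrderHomClass.mono f h)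
    · change y = ⊥ at h
      simp [h]
  · exact le_trans (by simp) (le_iSup _ ⟨(a, ⊤), Or.inl le_rfl⟩)

theorem desc_inr (f : FrameHom P M) (g : FrameHom N M) (b : N) : desc f g (inr b) = g b := by
  apply le_antisymm
  · refine iSup_le ?_
    rintro ⟨⟨x, y⟩, h | h⟩
    · exact inf_le_right.trans (OrderHomClass.mono g h)
    · change x = ⊥ at h
      simp [h]
  · exact le_trans (by simp) (le_iSup _ ⟨(⊤, b), Or.inl le_rfl⟩)

theorem hom_ext {f g : FrameHom (Coprod P N) M} (h : ∀ a, f (inl a) = g (inl a))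
    (h' : ∀ b, f (inr b) = g (inr b)) : f = g := by
  ext D
  rw [D.eq_iSup, map_iSup, map_iSup]
  simp only [map_inf, h, h']

end Coprod

/-- The finitary elements with respect to a pair of frame homomorphisms with common codomain:
finite joins of elements of the form `x⁺ ⊓ x⁻`. -/
def IsFinElt {P N L : Type u} [Order.Frame P] [Order.Frame N] [Order.Frame L]
    (ep : FrameHom P L) (en : FrameHom N L) (x : L) : Prop :=
  ∃ s : Finset (P × N), x = s.sup fun p => ep p.1 ⊓ en p.2

/-- A congruence is finitary if it is generated by a relation between finitary elements. -/
def IsFinCongr {P N L : Type u} [Order.Frame P] [Order.Frame N] [Order.Frame L]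
    (ep : FrameHom P L) (en : FrameHom N L) (C : FrameCongr L) : Prop :=
  ∃ R : L → L → Prop, (∀ x y, R x y → IsFinElt ep en x ∧ IsFinElt ep en y) ∧
    C = FrameCongr.gen R

/-- A biframe: frames `L⁺`, `L⁻`, `L` with injective frame homomorphisms `e⁺ : L⁺ → L` and
`e⁻ : L⁻ → L` such that every element of `L` is a join of elements `e⁺ x⁺ ⊓ e⁻ x⁻`. -/
structure Biframe where
  Pos : Type u
  Neg : Type u
  Main : Type u
  [framePos : Order.Frame Pos]
  [frameNeg : Order.Frame Neg]
  [frameMain : Order.Frame Main]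
  ePos : FrameHom Pos Main
  eNeg : FrameHom Neg Main
  ePos_injective : Function.Injective ePos
  eNeg_injective : Function.Injective eNeg
  generated : ∀ x : Main, ∃ s : Set (Pos × Neg), x = ⨆ p ∈ s, ePos p.1 ⊓ eNeg p.2

attribute [instance] Biframe.framePos Biframe.frameNeg Biframe.frameMain

/-- A morphism of biframes: a pair of frame homomorphisms which are both restrictions of a frame
homomorphism between the main components. -/
@[ext]
structure BiframeHom (L : Biframe.{u}) (M : Biframe.{v}) where
  pos : FrameHom L.Pos M.Pos
  neg : FrameHom L.Neg M.Neg
  exists_main : ∃ f : FrameHom L.Main M.Main,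
    (∀ a, f (L.ePos a) = M.ePos (pos a)) ∧ ∀ b, f (L.eNeg b) = M.eNeg (neg b)

namespace Biframe

theorem main_ext {L : Biframe.{u}} {M : Type v} [Order.Frame M] {f g : FrameHom L.Main M}
    (h : ∀ a, f (L.ePos a) = g (L.ePos a)) (h' : ∀ b, f (L.eNeg b) = g (L.eNeg b)) : f = g := by
  ext x
  obtain ⟨s, rfl⟩ := L.generated x
  simp only [map_iSup, map_inf, h, h']

end Biframe

namespace BiframeHom

variable {L : Biframe.{u}} {M : Biframe.{v}} {N : Biframe.{w}}

/-- The (unique) frame homomorphism between the main components. -/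
noncomputable def main (f : BiframeHom L M) : FrameHom L.Main M.Main := f.exists_main.choose

theorem main_ePos (f : BiframeHom L M) (a : L.Pos) : f.main (L.ePos a) = M.ePos (f.pos a) :=
  f.exists_main.choose_spec.1 a

theorem main_eNeg (f : BiframeHom L M) (b : L.Neg) : f.main (L.eNeg b) = M.eNeg (f.neg b) :=
  f.exists_main.choose_spec.2 b

/-- The identity morphism. -/
def id (L : Biframe.{u}) : BiframeHom L L :=
  ⟨FrameHom.id _, FrameHom.id _, FrameHom.id _, fun _ => rfl, fun _ => rfl⟩

/-- Composition of morphisms: first `f`, then `g`. -/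
def comp (g : BiframeHom M N) (f : BiframeHom L M) : BiframeHom L N :=
  ⟨g.pos.comp f.pos, g.neg.comp f.neg, g.main.comp f.main,
    fun a => by simp [main_ePos], fun b => by simp [main_eNeg]⟩

theorem id_main : (id L).main = FrameHom.id _ :=
  Biframe.main_ext (fun a => main_ePos _ a) (fun b => main_eNeg _ b)

theorem comp_main (g : BiframeHom M N) (f : BiframeHom L M) :
    (g.comp f).main = g.main.comp f.main :=
  Biframe.main_ext (fun a => by simp [main_ePos, comp]) (fun b => by simp [main_eNeg, comp])

end BiframeHom

open CategoryTheory

/-- The category of biframes. -/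
instance : Category Biframe.{u} where
  Hom L M := BiframeHom L M
  id L := BiframeHom.id L
  comp f g := g.comp f

namespace Biframe

/-- The canonical frame homomorphism `L⁺ ⊕ L⁻ → L`. -/
def canonical (L : Biframe.{u}) : FrameHom (Coprod L.Pos L.Neg) L.Main :=
  Coprod.desc L.ePos L.eNeg

theorem canonical_surjective (L : Biframe.{u}) : Function.Surjective L.canonical := by
  intro x
  obtain ⟨s, rfl⟩ := L.generated x
  exact ⟨⨆ p ∈ s, Coprod.inl p.1 ⊓ Coprod.inr p.2, by
    simp [canonical, map_iSup, map_inf, Coprod.desc_inl, Coprod.desc_inr]⟩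

/-- The congruence `C_L` on `L⁺ ⊕ L⁻` for which the canonical map induces an isomorphism
`(L⁺ ⊕ L⁻) / C_L ≅ L`. -/
def congr (L : Biframe.{u}) : FrameCongr.{u} (Coprod.{u, u} L.Pos L.Neg) :=
  FrameCongr.ker.{u, u} L.canonical

/-- A biframe is finitary if the congruence `C_L` on `L⁺ ⊕ L⁻` is finitary. -/
def IsFinitary : ObjectProperty Biframe.{u} :=
  fun L => IsFinCongr Coprod.inl.{u, u} Coprod.inr.{u, u} L.congr

/-- The biframe `(2, 2, 2)`, with the two-element frame of truth values. -/
@[reducible] def two : Biframe.{0} where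
  Pos := Prop
  Neg := Prop
  Main := Prop
  ePos := FrameHom.id _
  eNeg := FrameHom.id _
  ePos_injective := Function.injective_id
  eNeg_injective := Function.injective_id
  generated x := ⟨{(x, ⊤)}, by simp⟩

end Biframe

/-- Finitary biframes, as a full subcategory of the category of biframes. -/
abbrev FinBiframe : Type (u + 1) := Biframe.IsFinitary.{u}.FullSubcategory

/-! ### The assembly of a biframe -/

namespace Biframe

open FrameCongr

section

variable (L : Biframe.{u})

/-- The finitary elements of the main component. -/
def finElts : Set L.Main := {x | IsFinElt L.ePos L.eNeg x}

/-- The finitary assembly of `L`: the subframe of the frame of congruences of the main component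
which is generated by all `∇ x` and by `Δ s` with `s` finitary. -/
def assemblyMain : Subframe (FrameCongr L.Main) :=
  Subframe.closure (Set.range nabla ∪ delta '' L.finElts)

/-- The subframe generated by all `∇ a` with `a` positive and `Δ b` with `b` negative. -/
def assemblyPos : Subframe (FrameCongr L.Main) :=
  Subframe.closure (Set.range (fun a => nabla (L.ePos a)) ∪ Set.range (fun b => delta (L.eNeg b)))

/-- The subframe generated by all `∇ b` with `b` negative and `Δ a` with `a` positive. -/
def assemblyNeg : Subframe (FrameCongr L.Main) :=
  Subframe.closure (Set.range (fun b => nabla (L.eNeg b)) ∪ Set.range (fun a => delta (L.ePos a)))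

variable {L}

theorem ePos_mem_finElts (a : L.Pos) : L.ePos a ∈ L.finElts := ⟨{(a, ⊤)}, by simp⟩

theorem eNeg_mem_finElts (b : L.Neg) : L.eNeg b ∈ L.finElts := ⟨{(⊤, b)}, by simp⟩

theorem nabla_mem_main (x : L.Main) : nabla x ∈ L.assemblyMain :=
  Subframe.subset_closure (Or.inl ⟨x, rfl⟩)

theorem delta_mem_main {x : L.Main} (hx : x ∈ L.finElts) : delta x ∈ L.assemblyMain :=
  Subframe.subset_closure (Or.inr ⟨x, hx, rfl⟩)

theorem nabla_mem_pos (a : L.Pos) : nabla (L.ePos a) ∈ L.assemblyPos :=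
  Subframe.subset_closure (Or.inl ⟨a, rfl⟩)

theorem delta_mem_pos (b : L.Neg) : delta (L.eNeg b) ∈ L.assemblyPos :=
  Subframe.subset_closure (Or.inr ⟨b, rfl⟩)

theorem nabla_mem_neg (b : L.Neg) : nabla (L.eNeg b) ∈ L.assemblyNeg :=
  Subframe.subset_closure (Or.inl ⟨b, rfl⟩)

theorem delta_mem_neg (a : L.Pos) : delta (L.ePos a) ∈ L.assemblyNeg :=
  Subframe.subset_closure (Or.inr ⟨a, rfl⟩)

theorem assemblyPos_le : ∀ C ∈ L.assemblyPos, C ∈ L.assemblyMain := by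
  apply Subframe.closure_le
  rintro _ (⟨a, rfl⟩ | ⟨b, rfl⟩)
  · exact nabla_mem_main _
  · exact delta_mem_main (eNeg_mem_finElts b)

theorem assemblyNeg_le : ∀ C ∈ L.assemblyNeg, C ∈ L.assemblyMain := by
  apply Subframe.closure_le
  rintro _ (⟨a, rfl⟩ | ⟨b, rfl⟩)
  · exact nabla_mem_main _
  · exact delta_mem_main (ePos_mem_finElts b)

variable (L) in
/-- The canonical map from the coproduct of the two parts of the assembly. -/
def assemblyDesc : FrameHom (Coprod L.assemblyPos L.assemblyNeg) (FrameCongr L.Main) :=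
  Coprod.desc L.assemblyPos.subtype L.assemblyNeg.subtype

/-- Every element of the finitary assembly comes from the coproduct of the two parts. -/
theorem assemblyMain_le_range : ∀ C ∈ L.assemblyMain, C ∈ Subframe.range L.assemblyDesc := by
  have hp : ∀ C, ∀ h : C ∈ L.assemblyPos, L.assemblyDesc (Coprod.inl ⟨C, h⟩) = C :=
    fun C h => Coprod.desc_inl _ _ _
  have hn : ∀ C, ∀ h : C ∈ L.assemblyNeg, L.assemblyDesc (Coprod.inr ⟨C, h⟩) = C :=
    fun C h => Coprod.desc_inr _ _ _
  apply Subframe.closure_le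
  rintro _ (⟨x, rfl⟩ | ⟨_, ⟨s, rfl⟩, rfl⟩)
  · obtain ⟨s, rfl⟩ := L.generated x
    refine ⟨⨆ p ∈ s, Coprod.inl ⟨_, nabla_mem_pos p.1⟩ ⊓ Coprod.inr ⟨_, nabla_mem_neg p.2⟩, ?_⟩
    simp only [map_iSup, map_inf, hp, hn]
    change _ = nablaHom L.Main _
    simp only [map_iSup, map_inf]
    rfl
  · classical
    induction s using Finset.induction_on with
    | empty => exact ⟨⊤, by simp [delta_bot]⟩
    | insert p s _ ih =>
      obtain ⟨D, hD⟩ := ih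
      refine ⟨(Coprod.inr ⟨_, delta_mem_neg p.1⟩ ⊔ Coprod.inl ⟨_, delta_mem_pos p.2⟩) ⊓ D, ?_⟩
      rw [map_inf, map_sup, hp, hn, hD, Finset.sup_insert, delta_sup, delta_inf]

end

/-- The assembly `A(L)` of a biframe `L`. -/
def assembly (L : Biframe.{u}) : Biframe.{u} where
  Pos := L.assemblyPos
  Neg := L.assemblyNeg
  Main := L.assemblyMain
  ePos := Subframe.inclusion assemblyPos_le
  eNeg := Subframe.inclusion assemblyNeg_le
  ePos_injective _ _ h := Subtype.ext (Subtype.ext_iff.1 h :)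
  eNeg_injective _ _ h := Subtype.ext (Subtype.ext_iff.1 h :)
  generated C := by
    obtain ⟨D, hD⟩ := assemblyMain_le_range C.1 C.2
    refine ⟨{p | p ∈ D.1}, ?_⟩
    have inj : Function.Injective L.assemblyMain.subtype := Subtype.val_injective
    apply inj
    refine Eq.trans hD.symm (Eq.symm ?_)
    simp only [map_iSup, map_inf]
    exact Eq.symm <| iSup_subtype (p := fun p => p ∈ D.1)
      (f := fun p => (L.assemblyPos.subtype p.1.1 ⊓ L.assemblyNeg.subtype p.1.2 :
        FrameCongr L.Main))

/-- The canonical biframe morphism `∇ : L → A(L)`. -/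
def toAssembly (L : Biframe.{u}) : L ⟶ L.assembly where
  pos := Subframe.codRestrict ((nablaHom L.Main).comp L.ePos) L.assemblyPos nabla_mem_pos
  neg := Subframe.codRestrict ((nablaHom L.Main).comp L.eNeg) L.assemblyNeg nabla_mem_neg
  exists_main := ⟨Subframe.codRestrict (nablaHom L.Main) L.assemblyMain nabla_mem_main,
    fun _ => rfl, fun _ => rfl⟩

section map

variable {L M : Biframe.{u}} (f : L ⟶ M)

theorem main_mem_finElts {x : L.Main} (hx : x ∈ L.finElts) :
    BiframeHom.main f x ∈ M.finElts := by
  classical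
  obtain ⟨s, rfl⟩ := hx
  refine ⟨s.image fun p => (f.pos p.1, f.neg p.2), ?_⟩
  rw [map_finset_sup, Finset.sup_image]
  refine Finset.sup_congr rfl fun p _ => ?_
  simp [BiframeHom.main_ePos, BiframeHom.main_eNeg]

/-- The action of the assembly on morphisms: on generators it is given by `∇ a ↦ ∇ (f a)` and
`Δ b ↦ Δ (f b)`. -/
noncomputable def assemblyMap : L.assembly ⟶ M.assembly where
  pos := Subframe.restrict (mapHom (BiframeHom.main f)) L.assemblyPos M.assemblyPos <|
    Subframe.map_mem_closure <| by
      rintro _ (⟨a, rfl⟩ | ⟨b, rfl⟩)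
      · change FrameCongr.map _ (nabla _) ∈ _
        rw [map_nabla, BiframeHom.main_ePos]
        exact nabla_mem_pos _
      · change FrameCongr.map _ (delta _) ∈ _
        rw [map_delta, BiframeHom.main_eNeg]
        exact delta_mem_pos _
  neg := Subframe.restrict (mapHom (BiframeHom.main f)) L.assemblyNeg M.assemblyNeg <|
    Subframe.map_mem_closure <| by
      rintro _ (⟨b, rfl⟩ | ⟨a, rfl⟩)
      · change FrameCongr.map _ (nabla _) ∈ _
        rw [map_nabla, BiframeHom.main_eNeg]
        exact nabla_mem_neg _
      · change FrameCongr.map _ (delta _) ∈ _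
        rw [map_delta, BiframeHom.main_ePos]
        exact delta_mem_neg _
  exists_main := ⟨Subframe.restrict (mapHom (BiframeHom.main f)) L.assemblyMain M.assemblyMain <|
    Subframe.map_mem_closure <| by
      rintro _ (⟨x, rfl⟩ | ⟨s, hs, rfl⟩)
      · change FrameCongr.map _ (nabla _) ∈ _
        rw [map_nabla]
        exact nabla_mem_main _
      · change FrameCongr.map _ (delta _) ∈ _
        rw [map_delta]
        exact delta_mem_main (main_mem_finElts f hs), fun _ => rfl, fun _ => rfl⟩

end map

theorem mapHom_id {L : Type u} [Order.Frame L] (C : FrameCongr L) :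
    mapHom (FrameHom.id L) C = C :=
  le_antisymm (map_le.2 fun _ _ h => h) fun a b h => gen_of ⟨a, b, h, rfl, rfl⟩

theorem mapHom_comp {L M N : Type u} [Order.Frame L] [Order.Frame M] [Order.Frame N]
    (g : FrameHom M N) (f : FrameHom L M) (C : FrameCongr L) :
    mapHom (g.comp f) C = mapHom g (mapHom f C) := by
  apply eq_of_forall_ge_iff
  intro D
  exact map_le.trans (Iff.symm (map_le.trans map_le))

/-- The assembly functor on biframes. -/
noncomputable def assemblyFunctor : Biframe.{u} ⥤ Biframe.{u} where
  obj := assembly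
  map f := assemblyMap f
  map_id L := by
    have h : BiframeHom.main (𝟙 L) = FrameHom.id _ := BiframeHom.id_main
    apply BiframeHom.ext
    · ext C
      exact Subtype.ext ((congrArg (fun k => mapHom k C.1) h).trans (mapHom_id C.1))
    · ext C
      exact Subtype.ext ((congrArg (fun k => mapHom k C.1) h).trans (mapHom_id C.1))
  map_comp {L M N} f g := by
    have h : BiframeHom.main (f ≫ g) = (BiframeHom.main g).comp (BiframeHom.main f) :=
      BiframeHom.comp_main g f
    apply BiframeHom.ext
    · ext C
      exact Subtype.ext ((congrArg (fun k => mapHom k C.1) h).trans (mapHom_comp _ _ C.1))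
    · ext C
      exact Subtype.ext ((congrArg (fun k => mapHom k C.1) h).trans (mapHom_comp _ _ C.1))

theorem nabla_le_nabla {L : Type u} [Order.Frame L] {a b : L} (h : nabla a ≤ nabla b) :
    a ≤ b := by
  have h' : a ⊔ b = ⊥ ⊔ b := nabla_le.1 h
  simpa using h'

theorem delta_eq_nabla {L : Type u} [Order.Frame L] {a b : L} (h : IsCompl a b) :
    delta a = nabla b := by
  refine (isCompl a).right_unique (IsCompl.of_eq ?_ ?_)
  · rw [← show nabla (a ⊓ b) = nabla a ⊓ nabla b from map_inf (nablaHom L) a b, h.inf_eq_bot]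
    exact map_bot (nablaHom L)
  · rw [← show nabla (a ⊔ b) = nabla a ⊔ nabla b from map_sup (nablaHom L) a b, h.sup_eq_top,
      nabla_top]

/-- The assembly of a finitary biframe is finitary. -/
theorem assembly_isFinitary (L : Biframe.{u}) (hL : IsFinitary L) : IsFinitary L.assembly := by
  classical
  obtain ⟨R', hR', hgen⟩ := hL
  let CA := Coprod.{u, u} L.assembly.Pos L.assembly.Neg
  let c : FrameHom CA L.assembly.Main := L.assembly.canonical
  let Fin : CA → Prop := IsFinElt Coprod.inl.{u, u} Coprod.inr.{u, u}
  let R : CA → CA → Prop := fun x y => Fin x ∧ Fin y ∧ c x = c y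
  refine ⟨R, fun x y h => ⟨h.1, h.2.1⟩, ?_⟩
  refine le_antisymm ?_ (gen_le.2 fun x y h => h.2.2)
  let K : FrameCongr.{u} CA := gen R
  let q : FrameHom CA (Set.range K.toNucleus) := K.toNucleus.restrict
  have hq : ∀ x y, q x = q y ↔ K.r x y := fun x y => by
    rw [← K.toNucleus_eq, Subtype.ext_iff]
    rfl
  have hqR : ∀ x y, Fin x → Fin y → c x = c y → q x = q y := fun x y hx hy h =>
    (hq x y).2 (gen_of ⟨hx, hy, h⟩)
  let ι : FrameHom L.assembly.Main (FrameCongr L.Main) := L.assemblyMain.subtype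
  have hι : Function.Injective ι := Subtype.val_injective
  let t : FrameHom (Coprod.{u, u} L.Pos L.Neg) CA :=
    Coprod.desc (Coprod.inl.comp L.toAssembly.pos) (Coprod.inr.comp L.toAssembly.neg)
  have ht1 : ∀ a, t (Coprod.inl a) = Coprod.inl (L.toAssembly.pos a) := fun a =>
    Coprod.desc_inl _ _ a
  have ht2 : ∀ b, t (Coprod.inr b) = Coprod.inr (L.toAssembly.neg b) := fun b =>
    Coprod.desc_inr _ _ b
  have hc1 : ∀ a, c (Coprod.inl a) = L.assembly.ePos a := fun a => Coprod.desc_inl _ _ a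
  have hc2 : ∀ b, c (Coprod.inr b) = L.assembly.eNeg b := fun b => Coprod.desc_inr _ _ b
  have htc : c.comp t = (BiframeHom.main L.toAssembly).comp L.canonical := by
    apply Coprod.hom_ext
    · intro a
      simp [ht1, hc1, canonical, Coprod.desc_inl, BiframeHom.main_ePos]
    · intro b
      simp [ht2, hc2, canonical, Coprod.desc_inr, BiframeHom.main_eNeg]
  have htfin : ∀ x, IsFinElt Coprod.inl.{u, u} Coprod.inr.{u, u} x → Fin (t x) := by
    rintro _ ⟨s, rfl⟩
    refine ⟨s.image fun p => (L.toAssembly.pos p.1, L.toAssembly.neg p.2), ?_⟩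
    rw [map_finset_sup, Finset.sup_image]
    refine Finset.sup_congr rfl fun p _ => ?_
    simp [ht1, ht2]
  obtain ⟨g, hg⟩ := exists_factor L.canonical L.canonical_surjective (q.comp t) <| by
    refine le_trans (le_of_eq hgen) (gen_le.2 fun x y h => ?_)
    apply hqR _ _ (htfin x (hR' x y h).1) (htfin y (hR' x y h).2)
    have h1 : L.congr.r x y := by
      rw [hgen]
      exact gen_of h
    have h2 : L.canonical x = L.canonical y := h1
    have := congrArg (fun k => k x) htc
    have h3 := congrArg (fun k => k y) htc
    simp only [FrameHom.comp_apply] at this h3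
    rw [this, h3, h2]
  have hg1 : ∀ a, g (L.ePos a) = q (Coprod.inl (L.toAssembly.pos a)) := fun a => by
    have := hg (Coprod.inl a)
    rw [canonical, Coprod.desc_inl, FrameHom.comp_apply, ht1] at this
    exact this
  have hg2 : ∀ b, g (L.eNeg b) = q (Coprod.inr (L.toAssembly.neg b)) := fun b => by
    have := hg (Coprod.inr b)
    rw [canonical, Coprod.desc_inr, FrameHom.comp_apply, ht2] at this
    exact this
  have hcompl : ∀ (P : L.assembly.Pos) (N : L.assembly.Neg), IsCompl P.1 N.1 →
      IsCompl (q (Coprod.inl P)) (q (Coprod.inr N)) := by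
    intro P N h
    refine IsCompl.of_eq ?_ ?_
    · rw [← map_inf, ← map_bot q]
      refine hqR _ _ ⟨{(P, N)}, by simp⟩ ⟨∅, by simp⟩ ?_
      rw [map_inf, hc1, hc2, map_bot]
      apply hι
      rw [map_inf, map_bot]
      exact h.inf_eq_bot
    · rw [← map_sup, ← map_top q]
      refine hqR _ _ ⟨{(P, ⊤), (⊤, N)}, by simp⟩ ⟨{(⊤, ⊤)}, by simp⟩ ?_
      rw [map_sup, hc1, hc2, map_top]
      apply hι
      rw [map_sup, map_top]
      exact h.sup_eq_top
  have key1 : (mapHom g).comp L.assemblyPos.subtype = (nablaHom _).comp (q.comp Coprod.inl) := by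
    apply Subframe.hom_ext
    rintro _ (⟨a, rfl⟩ | ⟨b, rfl⟩)
    · refine (map_nabla g _).trans ?_
      rw [hg1]
      rfl
    · refine (map_delta g _).trans ?_
      rw [hg2]
      exact delta_eq_nabla (hcompl ⟨_, delta_mem_pos b⟩ (L.toAssembly.neg b) (isCompl _).symm).symm
  have key2 : (mapHom g).comp L.assemblyNeg.subtype = (nablaHom _).comp (q.comp Coprod.inr) := by
    apply Subframe.hom_ext
    rintro _ (⟨b, rfl⟩ | ⟨a, rfl⟩)
    · refine (map_nabla g _).trans ?_
      rw [hg2]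
      rfl
    · refine (map_delta g _).trans ?_
      rw [hg1]
      exact delta_eq_nabla (hcompl (L.toAssembly.pos a) ⟨_, delta_mem_neg a⟩ (isCompl _))
  have key : ((mapHom g).comp ι).comp c = (nablaHom _).comp q := by
    apply Coprod.hom_ext
    · intro P
      rw [FrameHom.comp_apply, FrameHom.comp_apply, hc1]
      exact congrArg (fun k => k P) key1
    · intro N
      rw [FrameHom.comp_apply, FrameHom.comp_apply, hc2]
      exact congrArg (fun k => k N) key2
  intro x y hxy
  replace hxy : c x = c y := hxy
  have h1 : nabla (q x) = nabla (q y) := by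
    have hx := congrArg (fun k => k x) key
    have hy := congrArg (fun k => k y) key
    rw [FrameHom.comp_apply, hxy] at hx
    exact hx.symm.trans hy
  exact (hq x y).1 (le_antisymm (nabla_le_nabla h1.le) (nabla_le_nabla h1.ge))

/-- The assembly functor on finitary biframes. -/
noncomputable def assemblyFin : FinBiframe.{u} ⥤ FinBiframe.{u} :=
  ObjectProperty.lift _ (ObjectProperty.ι _ ⋙ assemblyFunctor) fun L =>
    assembly_isFinitary L.obj L.property

end Biframe

/-! ### Bispaces, bispectra and Skula bispaces -/

/-- A bispace: a set with a positive and a negative topology. -/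
structure BiTop where
  carrier : Type u
  pos : TopologicalSpace carrier
  neg : TopologicalSpace carrier

open scoped Topology

namespace BiTop

/-- A bicontinuous map. -/
@[ext]
structure Hom (X : BiTop.{u}) (Y : BiTop.{v}) where
  toFun : X.carrier → Y.carrier
  continuous_pos : @Continuous _ _ X.pos Y.pos toFun
  continuous_neg : @Continuous _ _ X.neg Y.neg toFun

/-- The category of bispaces; its isomorphisms are the bihomeomorphisms. -/
instance : Category BiTop.{u} where
  Hom X Y := Hom X Y
  id X := ⟨fun x => x, @continuous_id _ X.pos, @continuous_id _ X.neg⟩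
  comp {X Y Z} f g := ⟨fun x => g.toFun (f.toFun x),
    @Continuous.comp _ _ _ X.pos Y.pos Z.pos _ _ g.continuous_pos f.continuous_pos,
    @Continuous.comp _ _ _ X.neg Y.neg Z.neg _ _ g.continuous_neg f.continuous_neg⟩

/-- The topology generated by the open sets of `s` and the closed sets of `t`. -/
@[reducible] def skulaTopology {X : Type u} (s t : TopologicalSpace X) : TopologicalSpace X :=
  TopologicalSpace.generateFrom ({U | IsOpen[s] U} ∪ {V | IsClosed[t] V})

theorem continuous_skulaTopology {X Y : Type u} {s t : TopologicalSpace X}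
    {s' t' : TopologicalSpace Y} {f : X → Y} (h : Continuous[s, s'] f) (h' : Continuous[t, t'] f) :
    Continuous[skulaTopology s t, skulaTopology s' t'] f := by
  rw [skulaTopology, continuous_generateFrom_iff]
  rintro U (hU | hU)
  · exact TopologicalSpace.GenerateOpen.basic _ (Or.inl ((@continuous_def _ _ s s' f).1 h U hU))
  · exact TopologicalSpace.GenerateOpen.basic _ (Or.inr ((@continuous_iff_isClosed _ _ t t' f).1 h' U hU))

/-- The Skula functor: the positive topology of `Sk(X)` is generated by the positive open sets and
the negative closed sets of `X`, the negative one by the negative open sets and the positive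
closed sets. -/
def skula : BiTop.{u} ⥤ BiTop.{u} where
  obj X := ⟨X.carrier, skulaTopology X.pos X.neg, skulaTopology X.neg X.pos⟩
  map f := ⟨f.toFun, continuous_skulaTopology f.continuous_pos f.continuous_neg,
    continuous_skulaTopology f.continuous_neg f.continuous_pos⟩

end BiTop

/-- For a family of points of a frame, the topology whose open sets are the sets
`{x | f x a = 1}` for `a` in the frame. -/
@[reducible] def pointTopology {X : Type v} {P : Type u} [Order.Frame P] (f : X → FrameHom P Prop) :
    TopologicalSpace X where
  IsOpen U := ∃ a, U = {x | f x a = ⊤}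
  isOpen_univ := ⟨⊤, by simp⟩
  isOpen_inter := by
    rintro _ _ ⟨a, rfl⟩ ⟨b, rfl⟩
    exact ⟨a ⊓ b, by ext x; simp⟩
  isOpen_sUnion S hS := by
    refine ⟨sSup {a | {x | f x a = ⊤} ∈ S}, ?_⟩
    ext x
    have key : f x (sSup {a | {x | f x a = ⊤} ∈ S}) = ⊤ ↔ ∃ a, {x | f x a = ⊤} ∈ S ∧ f x a = ⊤ := by
      rw [map_sSup]
      simp only [sSup_Prop_eq, Prop.top_eq_true, eq_iff_iff, iff_true, Set.mem_image,
        Set.mem_ofPred_eq]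
      exact ⟨fun ⟨_, ⟨a, ha, e⟩, h⟩ => ⟨a, ha, e.mpr h⟩, fun ⟨a, ha, h⟩ => ⟨_, ⟨a, ha, Iff.rfl⟩, h⟩⟩
    refine Iff.trans ?_ key.symm
    constructor
    · rintro ⟨U, hU, hx⟩
      obtain ⟨a, rfl⟩ := hS U hU
      exact ⟨a, hU, hx⟩
    · rintro ⟨a, ha, hx⟩
      exact ⟨_, ha, hx⟩

namespace Biframe

/-- The points of a biframe: the biframe morphisms to `(2, 2, 2)`. -/
abbrev Point (L : Biframe.{u}) : Type u := BiframeHom L two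

/-- The bispectrum functor. -/
def bpt : Biframe.{u}ᵒᵖ ⥤ BiTop.{u} where
  obj L :=
    { carrier := Point L.unop
      pos := pointTopology fun p : Point L.unop => p.pos
      neg := pointTopology fun p : Point L.unop => p.neg }
  map {L M} f :=
    { toFun := fun p => BiframeHom.comp p f.unop
      continuous_pos := by
        refine @Continuous.mk _ _ (_) (_) _ ?_
        rintro _ ⟨a, rfl⟩
        exact ⟨f.unop.pos a, rfl⟩
      continuous_neg := by
        refine @Continuous.mk _ _ (_) (_) _ ?_
        rintro _ ⟨a, rfl⟩
        exact ⟨f.unop.neg a, rfl⟩ }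

/-- The bispectrum functor on finitary biframes. -/
def bptFin : FinBiframe.{u}ᵒᵖ ⥤ BiTop.{u} :=
  (ObjectProperty.ι _).op ⋙ bpt

end Biframe

end Bif

open CategoryTheory Bif

/-!
A point `p : L → 2` has a main component `f : L.Main → Prop`, and the frame `A(Prop)` of
congruences on the two-element frame is `Prop` again: a congruence on `Prop` is trivial or total,
according to whether it identifies `1` with `0`. Composing the functorial map
`A(f) : A(L.Main) → A(Prop)` with `A(Prop) → Prop` gives a frame homomorphism `Point.congrHom`, and
its restrictions to the parts of the assembly are a point `p~` of `A(L)` with `p~ ∘ ∇ = p`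
(`Point.lift`).

It is the only one: in the main part of the assembly `Δ (e⁻ b)` is the complement of `∇ (e⁻ b)`,
so the values of a point `q` of `A(L)` at the generators `∇ (e⁺ a)` and `Δ (e⁻ b)` of the positive
part are `p⁺ a` and `¬ p⁻ b` for `p = q ∘ ∇` (`Point.pos_delta`), and dually for the negative part.

These two formulas also say that the inverse images under `p ↦ p~` of the generating open sets are
the positive open and the negative closed sets of the bispectrum, which generate the positive
Skula topology; hence `p ↦ p~` is a bihomeomorphism. Naturality follows from the uniqueness of
lifts, because `∇` is a natural transformation.
-/

namespace Bif

open CategoryTheory FrameCongr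

open scoped Topology

/-! ### Congruences on the two-element frame -/

namespace FrameCongr

theorem eq_bot_of_not_r (C : FrameCongr Prop) (h : ¬ C.r ⊤ ⊥) : C = ⊥ := by
  have h' : ¬ C.r ⊥ ⊤ := fun h' => h (C.iseqv.symm h')
  refine eq_bot_iff.2 fun a b hab => ?_
  have e : a = b := by
    by_cases ha : a <;> by_cases hb : b
    · simp [ha, hb]
    · rw [eq_true ha, eq_false hb] at hab
      exact (h hab).elim
    · rw [eq_false ha, eq_true hb] at hab
      exact (h' hab).elim
    · simp [ha, hb]
  exact e ▸ FrameCongr.refl _ a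

theorem bot_r {L : Type u} [Order.Frame L] {a b : L} : (⊥ : FrameCongr L).r a b ↔ a = b :=
  ⟨fun h => (bot_le : ⊥ ≤ ker (FrameHom.id L)) a b h, fun h => h ▸ FrameCongr.refl _ a⟩

/-- The isomorphism `A(Prop) → Prop`, `C ↦ (C identifies 1 with 0)`, as a frame homomorphism. -/
def evalTop : FrameHom (FrameCongr Prop) Prop where
  toFun C := C.r ⊤ ⊥
  map_inf' _ _ := rfl
  map_top' := eq_true ((le_top : nabla (⊤ : Prop) ≤ ⊤) _ _ (by simp [nabla]))
  map_sSup' S := by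
    rw [sSup_Prop_eq]
    refine propext ⟨fun h => ?_, ?_⟩
    · by_contra hS
      have e : sSup S = ⊥ := sSup_eq_bot.2 fun C hC =>
        eq_bot_of_not_r C fun h' => hS ⟨_, ⟨C, hC, rfl⟩, h'⟩
      rw [e, bot_r] at h
      exact top_ne_bot h
    · rintro ⟨_, ⟨C, hC, rfl⟩, h⟩
      exact (le_sSup hC : C ≤ sSup S) _ _ h

theorem evalTop_nabla (a : Prop) : evalTop (nabla a) = a := by
  change (⊤ ⊔ a = ⊥ ⊔ a) = a
  by_cases h : a <;> simp [h]

end FrameCongr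

/-! ### Lifting points to the assembly -/

theorem Subframe.isCompl_of_val {L : Type u} [Order.Frame L] {S : Subframe L} {a b : S}
    (h : IsCompl a.1 b.1) : IsCompl a b :=
  ⟨fun _ hc hc' => le_trans (b := (⟨⊥, (sSup_empty (α := L)) ▸ S.sSup_mem (Set.empty_subset _)⟩ : S))
    (h.disjoint hc hc') (bot_le : (⊥ : L) ≤ (⊥ : S).1), fun _ hc hc' => h.codisjoint hc hc'⟩

theorem BiframeHom.comp_assoc {K : Biframe.{u}} {L : Biframe.{u}} {M : Biframe.{v}}
    {N : Biframe.{w}} (h : BiframeHom M N) (g : BiframeHom L M) (f : BiframeHom K L) :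
    (h.comp g).comp f = h.comp (g.comp f) := rfl

namespace Biframe

variable {L : Biframe.{u}}

/-- The structure maps of `two` are identities, so `p.main` extends the two parts of `p`. -/
theorem Point.main_ePos (p : L.Point) (a : L.Pos) : p.main (L.ePos a) = p.pos a :=
  BiframeHom.main_ePos p a

theorem Point.main_eNeg (p : L.Point) (b : L.Neg) : p.main (L.eNeg b) = p.neg b :=
  BiframeHom.main_eNeg p b

/-- The frame homomorphism `A(L.Main) → A(Prop) ≅ Prop` induced by a point of `L`. -/
noncomputable def Point.congrHom (p : L.Point) : FrameHom (FrameCongr L.Main) Prop :=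
  evalTop.comp (mapHom p.main)

theorem Point.congrHom_nabla (p : L.Point) (x : L.Main) : p.congrHom (nabla x) = p.main x :=
  (congrArg evalTop (map_nabla p.main x)).trans (evalTop_nabla _)

theorem Point.congrHom_delta (p : L.Point) (x : L.Main) :
    p.congrHom (delta x) = ¬ p.main x := by
  rw [← p.congrHom_nabla]
  exact ((isCompl x).map p.congrHom).compl_eq.symm

/-- The extension of a point of `L` to the assembly of `L`. -/
noncomputable def Point.lift (p : L.Point) : L.assembly.Point where
  pos := p.congrHom.comp L.assemblyPos.subtype
  neg := p.congrHom.comp L.assemblyNeg.subtype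
  exists_main := ⟨p.congrHom.comp L.assemblyMain.subtype, fun _ => rfl, fun _ => rfl⟩

theorem Point.lift_comp (p : L.Point) : p.lift.comp L.toAssembly = p := by
  apply BiframeHom.ext
  · ext a : 1
    exact (p.congrHom_nabla _).trans (p.main_ePos a)
  · ext b : 1
    exact (p.congrHom_nabla _).trans (p.main_eNeg b)

/-- The main component of `q` preserves complements, so the value of `q` at `Δ (e⁻ b)`, which lies
in the positive part of the assembly, is forced by its value at `∇ (e⁻ b)` in the negative part. -/
theorem Point.pos_delta (q : L.assembly.Point) (b : L.Neg) :
    q.pos ⟨delta (L.eNeg b), delta_mem_pos b⟩ = ¬ (q.comp L.toAssembly).neg b := by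
  have h : IsCompl (L.assembly.eNeg ⟨nabla (L.eNeg b), nabla_mem_neg b⟩)
      (L.assembly.ePos ⟨delta (L.eNeg b), delta_mem_pos b⟩) :=
    Subframe.isCompl_of_val (isCompl _)
  exact (q.main_ePos _).symm.trans
    ((h.map q.main).compl_eq.symm.trans (congrArg Not (q.main_eNeg _)))

theorem Point.neg_delta (q : L.assembly.Point) (a : L.Pos) :
    q.neg ⟨delta (L.ePos a), delta_mem_neg a⟩ = ¬ (q.comp L.toAssembly).pos a := by
  have h : IsCompl (L.assembly.ePos ⟨nabla (L.ePos a), nabla_mem_pos a⟩)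
      (L.assembly.eNeg ⟨delta (L.ePos a), delta_mem_neg a⟩) :=
    Subframe.isCompl_of_val (isCompl _)
  exact (q.main_eNeg _).symm.trans
    ((h.map q.main).compl_eq.symm.trans (congrArg Not (q.main_ePos _)))

/-- Points of the assembly are determined by their restrictions along `∇`. -/
theorem Point.comp_toAssembly_injective :
    Function.Injective fun q : L.assembly.Point => q.comp L.toAssembly := by
  intro q r h
  replace h : q.comp L.toAssembly = r.comp L.toAssembly := h
  apply BiframeHom.ext
  · apply Subframe.hom_ext
    rintro _ (⟨a, rfl⟩ | ⟨b, rfl⟩)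
    · exact congrArg (fun p : L.Point => p.pos a) h
    · exact (q.pos_delta b).trans (h ▸ (r.pos_delta b).symm)
  · apply Subframe.hom_ext
    rintro _ (⟨b, rfl⟩ | ⟨a, rfl⟩)
    · exact congrArg (fun p : L.Point => p.neg b) h
    · exact (q.neg_delta a).trans (h ▸ (r.neg_delta a).symm)

theorem Point.lift_comp_toAssembly (q : L.assembly.Point) :
    Point.lift (q.comp L.toAssembly) = q :=
  Point.comp_toAssembly_injective (Point.lift_comp _)

/-! ### The bihomeomorphism -/

/-- The congruences `C` on `L.Main` for which the set of points of `L` whose extension takes the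
value `1` at `C` is open. Since they form a subframe, openness on the parts of the assembly needs to
be checked on generators only. -/
def openCongr (L : Biframe.{u}) (t : TopologicalSpace L.Point) :
    Subframe (FrameCongr L.Main) where
  carrier := {C | IsOpen[t] {p : L.Point | p.congrHom C}}
  top_mem := by
    have e : {p : L.Point | p.congrHom ⊤} = Set.univ :=
      Set.eq_univ_of_forall fun p => of_eq_true (map_top p.congrHom)
    change IsOpen[t] {p : L.Point | p.congrHom ⊤}
    exact e ▸ isOpen_univ
  inf_mem {C D} hC hD := by
    change IsOpen[t] {p : L.Point | p.congrHom (C ⊓ D)}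
    simp only [map_inf]
    exact IsOpen.inter hC hD
  sSup_mem {S} hS := by
    have e : {p : L.Point | p.congrHom (sSup S)} = ⋃ C ∈ S, {p : L.Point | p.congrHom C} := by
      ext p
      change p.congrHom (sSup S) ↔ _
      rw [map_sSup, sSup_Prop_eq, Set.mem_iUnion₂]
      exact ⟨fun ⟨_, ⟨C, hC, rfl⟩, h⟩ => ⟨C, hC, h⟩, fun ⟨C, hC, h⟩ => ⟨_, ⟨C, hC, rfl⟩, h⟩⟩
    change IsOpen[t] {p : L.Point | p.congrHom (sSup S)}
    exact e ▸ isOpen_biUnion fun C hC => hS hC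

/-- The positive topology of the bispectrum. -/
abbrev posTopology (L : Biframe.{u}) : TopologicalSpace L.Point :=
  pointTopology fun p : L.Point => p.pos

/-- The negative topology of the bispectrum. -/
abbrev negTopology (L : Biframe.{u}) : TopologicalSpace L.Point :=
  pointTopology fun p : L.Point => p.neg

theorem assemblyPos_le_openCongr : ∀ C ∈ L.assemblyPos,
    C ∈ L.openCongr (BiTop.skulaTopology L.posTopology L.negTopology) := by
  apply Subframe.closure_le
  rintro _ (⟨a, rfl⟩ | ⟨b, rfl⟩)
  · refine TopologicalSpace.GenerateOpen.basic _ (Or.inl ⟨a, ?_⟩)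
    exact Set.ext fun p => (iff_of_eq ((p.congrHom_nabla _).trans (p.main_ePos _))).trans
      ⟨eq_true, of_eq_true⟩
  · refine TopologicalSpace.GenerateOpen.basic _
      (Or.inr ((@isOpen_compl_iff _ _ L.negTopology).1 ⟨b, ?_⟩))
    exact Set.ext fun p => (not_congr (iff_of_eq ((p.congrHom_delta _).trans
      (congrArg Not (p.main_eNeg _))))).trans (not_not.trans ⟨eq_true, of_eq_true⟩)

theorem assemblyNeg_le_openCongr : ∀ C ∈ L.assemblyNeg,
    C ∈ L.openCongr (BiTop.skulaTopology L.negTopology L.posTopology) := by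
  apply Subframe.closure_le
  rintro _ (⟨b, rfl⟩ | ⟨a, rfl⟩)
  · refine TopologicalSpace.GenerateOpen.basic _ (Or.inl ⟨b, ?_⟩)
    exact Set.ext fun p => (iff_of_eq ((p.congrHom_nabla _).trans (p.main_eNeg _))).trans
      ⟨eq_true, of_eq_true⟩
  · refine TopologicalSpace.GenerateOpen.basic _
      (Or.inr ((@isOpen_compl_iff _ _ L.posTopology).1 ⟨a, ?_⟩))
    exact Set.ext fun p => (not_congr (iff_of_eq ((p.congrHom_delta _).trans
      (congrArg Not (p.main_ePos _))))).trans (not_not.trans ⟨eq_true, of_eq_true⟩)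

theorem continuous_lift_pos :
    Continuous[BiTop.skulaTopology L.posTopology L.negTopology, L.assembly.posTopology]
      (Point.lift (L := L)) := by
  refine @Continuous.mk _ _ (_) (_) _ ?_
  rintro _ ⟨C, rfl⟩
  have e : {p : L.Point | p.congrHom C.1} = {p | p.congrHom C.1 = ⊤} :=
    Set.ext fun p => ⟨eq_true, of_eq_true⟩
  exact (congrArg _ e).mp (assemblyPos_le_openCongr C.1 C.2)

theorem continuous_lift_neg :
    Continuous[BiTop.skulaTopology L.negTopology L.posTopology, L.assembly.negTopology]
      (Point.lift (L := L)) := by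
  refine @Continuous.mk _ _ (_) (_) _ ?_
  rintro _ ⟨C, rfl⟩
  have e : {p : L.Point | p.congrHom C.1} = {p | p.congrHom C.1 = ⊤} :=
    Set.ext fun p => ⟨eq_true, of_eq_true⟩
  exact (congrArg _ e).mp (assemblyNeg_le_openCongr C.1 C.2)

theorem continuous_comp_toAssembly_pos :
    Continuous[L.assembly.posTopology, BiTop.skulaTopology L.posTopology L.negTopology]
      (fun q : L.assembly.Point => q.comp L.toAssembly) := by
  rw [BiTop.skulaTopology, continuous_generateFrom_iff]
  rintro U (⟨a, rfl⟩ | hU)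
  · exact ⟨L.toAssembly.pos a, rfl⟩
  · obtain ⟨b, hb⟩ := (@isOpen_compl_iff _ _ L.negTopology).2 hU
    refine ⟨⟨delta (L.eNeg b), delta_mem_pos b⟩, ?_⟩
    rw [compl_eq_comm] at hb
    subst hb
    exact Set.ext fun q => (not_congr ⟨of_eq_true, eq_true⟩).trans
      ((iff_of_eq (q.pos_delta b)).symm.trans ⟨eq_true, of_eq_true⟩)

theorem continuous_comp_toAssembly_neg :
    Continuous[L.assembly.negTopology, BiTop.skulaTopology L.negTopology L.posTopology]
      (fun q : L.assembly.Point => q.comp L.toAssembly) := by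
  rw [BiTop.skulaTopology, continuous_generateFrom_iff]
  rintro U (⟨b, rfl⟩ | hU)
  · exact ⟨L.toAssembly.neg b, rfl⟩
  · obtain ⟨a, ha⟩ := (@isOpen_compl_iff _ _ L.posTopology).2 hU
    refine ⟨⟨delta (L.ePos a), delta_mem_neg a⟩, ?_⟩
    rw [compl_eq_comm] at ha
    subst ha
    exact Set.ext fun q => (not_congr ⟨of_eq_true, eq_true⟩).trans
      ((iff_of_eq (q.neg_delta a)).symm.trans ⟨eq_true, of_eq_true⟩)

variable (L) in
/-- The bihomeomorphism between the Skula bispace of the bispectrum of `L` and the bispectrum of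
the assembly of `L`, given by the extension of points. -/
noncomputable def skulaIso :
    BiTop.skula.obj (bpt.obj (Opposite.op L)) ≅ bpt.obj (Opposite.op L.assembly) where
  hom := ⟨Point.lift, continuous_lift_pos, continuous_lift_neg⟩
  inv := ⟨fun q => BiframeHom.comp q L.toAssembly, continuous_comp_toAssembly_pos,
    continuous_comp_toAssembly_neg⟩
  hom_inv_id := BiTop.Hom.ext (funext Point.lift_comp)
  inv_hom_id := BiTop.Hom.ext (funext Point.lift_comp_toAssembly)

/-! ### Naturality -/

/-- The morphisms `∇ : L → A(L)` are natural. -/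
theorem assemblyMap_comp_toAssembly {M : Biframe.{u}} (f : L ⟶ M) :
    BiframeHom.comp (assemblyMap f) L.toAssembly = BiframeHom.comp M.toAssembly f := by
  apply BiframeHom.ext
  · ext a : 1
    apply Subtype.ext
    exact (map_nabla _ _).trans (congrArg nabla (BiframeHom.main_ePos f a))
  · ext b : 1
    apply Subtype.ext
    exact (map_nabla _ _).trans (congrArg nabla (BiframeHom.main_eNeg f b))

theorem Point.lift_natural {M : Biframe.{u}} (f : L ⟶ M) (p : M.Point) :
    Point.lift (BiframeHom.comp p f) = BiframeHom.comp p.lift (assemblyMap f) := by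
  apply Point.comp_toAssembly_injective
  change BiframeHom.comp (Point.lift (BiframeHom.comp p f)) L.toAssembly =
    BiframeHom.comp (BiframeHom.comp p.lift (assemblyMap f)) L.toAssembly
  rw [Point.lift_comp, BiframeHom.comp_assoc, assemblyMap_comp_toAssembly,
    ← BiframeHom.comp_assoc, Point.lift_comp]

/-- The natural isomorphism between `Sk ∘ bpt` and `bpt ∘ A` on finitary biframes. -/
noncomputable def skulaNatIso :
    bptFin.{u} ⋙ BiTop.skula ≅ assemblyFin.op ⋙ bptFin :=
  NatIso.ofComponents (fun L => skulaIso L.unop.obj) fun f =>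
    BiTop.Hom.ext (funext fun p => Point.lift_natural f.unop.hom p)

end Biframe

end Bif

theorem mainTheorem9 :
    (∀ L : Biframe.{u},
      (∀ p : L.Point, ∃! q : L.assembly.Point, q.comp L.toAssembly = p) ∧
      ∃ e : BiTop.skula.obj (Biframe.bpt.obj (Opposite.op L)) ≅
          Biframe.bpt.obj (Opposite.op L.assembly),
        ∀ p : L.Point, BiframeHom.comp (e.hom.toFun p) L.toAssembly = p) ∧
    ∃ α : Biframe.bptFin.{u} ⋙ BiTop.skula ≅ Biframe.assemblyFin.op ⋙ Biframe.bptFin,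
      ∀ (L : FinBiframe.{u}) (p : L.obj.Point),
        BiframeHom.comp ((α.hom.app (Opposite.op L)).toFun p) L.obj.toAssembly = p :=
  ⟨fun L => ⟨fun p => ⟨p.lift, p.lift_comp, fun _ hq =>
      Biframe.Point.comp_toAssembly_injective (hq.trans p.lift_comp.symm)⟩,
    L.skulaIso, Biframe.Point.lift_comp⟩,
  Biframe.skulaNatIso, fun _ => Biframe.Point.lift_comp⟩
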